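/- Let $\mathbb{T}=\mathbb{R}/\mathbb{Z}$ be the circle with its quotient distance $d$, and let $\mathbb{T}^2$ carry the product distance. Let $K\subset\mathbb{T}$ be the image, under the projection $\mathbb{R}\to\mathbb{T}$, of the middle-third Cantor set, and let $\kappa=\log 2/\log 3$ be its Hausdorff dimension. For an irrational point $\xi\in\mathbb{T}$ (one that is not the projection of a rational number), define its irrationality exponent by $$\mu(\xi)=\sup\bigl\{s\in\mathbb{R} : d(\xi,p/q)<q^{-s}\text{ for infinitely many pairs of integers }(p,q)\text{ with }0\le p<q,\ \gcd(p,q)=1\bigr\}\in[2,\infty],$$ and set $\mu(\xi)=1$ if $\xi$ is rational. For every real number $\mu\ge 2$, let $$\mathcal{M}^{\times}(\mu)=\bigl\{(\xi,\alpha)\in\mathbb{T}^{2} : \xi\in\alpha+K\text{ and }\mu(\xi)\ge\mu\bigr\}.$$ Then, for every real number $\mu\ge 2$, $$\dim_{\mathrm{H}}\mathcal{M}^{\times}(\mu)=\frac{2}{\mu}+\kappa .$$ -/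

import Mathlib

noncomputable section

namespace CantorApprox

/-- The circle `𝕋 = ℝ/ℤ`, with its usual quotient distance `dist`. -/
abbrev Circ : Type := UnitAddCircle

/-- Pairs `(p, q)` of integers with `0 ≤ p < q` and `gcd(p, q) = 1`. Every rational point of the
circle is `p / q` for exactly one such pair. -/
def reducedPairs : Set (ℕ × ℕ) := {x | x.1 < x.2 ∧ Nat.Coprime x.1 x.2}

/-- The point of the circle represented by the rational number `p / q`. -/
def ratPoint (p q : ℕ) : Circ := (((p : ℝ) / (q : ℝ) : ℝ) : UnitAddCircle)

/-- The rational points of the circle: the projections of the rational numbers. -/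
def IsRationalPoint (ξ : Circ) : Prop := ∃ r : ℚ, ((r : ℝ) : UnitAddCircle) = ξ

/-- `dist ξ (p / q) < q ^ (-s)` for infinitely many reduced pairs `(p, q)`. -/
def ApproxInfinitelyOften (ξ : Circ) (s : ℝ) : Prop :=
  {x ∈ reducedPairs | dist ξ (ratPoint x.1 x.2) < (x.2 : ℝ) ^ (-s)}.Infinite

open Classical in
/-- The irrationality exponent of a point of the circle: `1` at rational points, and otherwise the
supremum of the real `s` at which the point is approximable infinitely often. The supremum is taken
in the extended reals, as it is `+∞` at Liouville points. -/
def irrExponent (ξ : Circ) : EReal :=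
  if IsRationalPoint ξ then 1 else sSup {t : EReal | ∃ s : ℝ, ApproxInfinitelyOften ξ s ∧ t = s}

/-- The projection to the circle of the middle-third Cantor set. -/
def cantorCirc : Set Circ := (fun x : ℝ => (x : UnitAddCircle)) '' cantorSet

/-- The rotated Cantor set `α + K`. -/
def rotatedCantor (α : Circ) : Set Circ := (fun x : Circ => α + x) '' cantorCirc

/-- The set of pairs `(ξ, α)` in the torus `𝕋²` such that `ξ ∈ α + K` and the irrationality
exponent of `ξ` is at least `μ`. -/
def doublyMetricSet (μ : ℝ) : Set (Circ × Circ) :=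
  {x | x.1 ∈ rotatedCantor x.2 ∧ (μ : EReal) ≤ irrExponent x.1}

end CantorApprox

end

/-!
The shear `(ξ, α) ↦ (ξ, ξ - α)` is a Lipschitz involution of the torus, and it carries the set of
pairs to the product `W × K`, where `W` consists of the points with irrationality exponent at least
`μ` (`dimH_doublyMetricSet`). So the claim is that `dim (W × K) = 2 / μ + κ`.

*Upper bound* (`hausdorffMeasure_wellApproximable_prod`). For `τ < μ` every point of `W` lies in
infinitely many of the balls of radius `q ^ (-τ)` about rational points `p / q`. At scale `q ^ (-τ)`
the set `K` is covered by `O(q ^ (τ κ))` sets, so the products of balls with these sets have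
`(σ + κ)`-dimensional sum of the order of `∑ q ^ (1 - τ σ)`, which converges when `τ σ > 2`.

*Lower bound*. Suppose that `f` maps a subset `A` of the line into `W` with
`|t - t'| ≤ C dist (f t) (f t') ^ s`, and that `g` maps a subset `B` of the line into `K` in the
same way with exponent `κ`. A set of diameter `d` in `W × K` then pulls back into a rectangle of
area `O(d ^ (s + κ))`, so the push-forward of planar Lebesgue measure on `A × B` bounds the Hausdorff
measure from below (`add_le_dimH_of_antiHolder`). No Frostman measure and no measurability is
needed.

For `K`, `g` turns binary digits into ternary digits `0` and `2` (`exists_antiHolder_cantorSet`).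
For `W` and `s < 2 / μ`, `f` parametrizes the limit set of a tree of intervals about rationals
(`exists_antiHolder_of_tree`, `exists_antiHolder_approximable`): an interval of length `r` contains
of the order of `n ^ 2 r` rationals of denominator at most `n`, which are `n ^ (-2)`-separated
(`eventually_exists_finset_rat`), and around each of them there is an interval of length of the
order of `n ^ (-μ)` in the next generation. The parameters with rational image are countably many and are
discarded.
-/

namespace CantorApprox

open Set Filter Topology MeasureTheory
open scoped NNReal ENNReal

/-! ### Lower bounds for the dimension of a product -/

theorem ediam_le_of_antiHolder {X : Type*} [MetricSpace X] {A : Set ℝ} {f : ℝ → X} {s C : ℝ≥0}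
    (hf : ∀ t ∈ A, ∀ t' ∈ A, edist t t' ≤ C * edist (f t) (f t') ^ (s : ℝ)) {P : Set ℝ}
    (hP : P ⊆ A) {d : ℝ≥0∞} (hd : ∀ t ∈ P, ∀ t' ∈ P, edist (f t) (f t') ≤ d) :
    Metric.ediam P ≤ C * d ^ (s : ℝ) :=
  Metric.ediam_le fun t ht t' ht' => (hf t (hP ht) t' (hP ht')).trans <| by
    gcongr
    exact hd t ht t' ht'

/-- Mass distribution for a product of two expanding parametrizations: a set that contains
`f '' A ×ˢ g '' B` has dimension at least the sum of the two exponents. The sets and maps need not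
be measurable, since the comparison is between outer measures. -/
theorem add_le_dimH_of_antiHolder {X Y : Type*} [MetricSpace X] [MetricSpace Y] {A B : Set ℝ}
    {f : ℝ → X} {g : ℝ → Y} {s κ C C' : ℝ≥0} (hC : C ≠ 0) (hC' : C' ≠ 0)
    (hf : ∀ t ∈ A, ∀ t' ∈ A, edist t t' ≤ C * edist (f t) (f t') ^ (s : ℝ))
    (hg : ∀ t ∈ B, ∀ t' ∈ B, edist t t' ≤ C' * edist (g t) (g t') ^ (κ : ℝ))
    (hA : volume A ≠ 0) (hB : volume B ≠ 0) {E : Set (X × Y)}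
    (hE : ∀ t ∈ A, ∀ u ∈ B, (f t, g u) ∈ E) : ((s + κ : ℝ≥0) : ℝ≥0∞) ≤ dimH E := by
  borelize (X × Y)
  apply le_dimH_of_hausdorffMeasure_ne_zero
  intro h0
  let φ : ℝ × ℝ → X × Y := fun p => (f p.1, g p.2)
  let ν : OuterMeasure (X × Y) := OuterMeasure.map φ
    (OuterMeasure.restrict (A ×ˢ B) (volume : Measure (ℝ × ℝ)).toOuterMeasure)
  have hν (U : Set (X × Y)) : ν U = volume (φ ⁻¹' U ∩ A ×ˢ B) := by
    simp [ν]
  have key (U : Set (X × Y)) :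
      ν U ≤ (C * C' : ℝ≥0) * Metric.ediam U ^ ((s + κ : ℝ≥0) : ℝ) := by
    rw [hν]
    set P : Set ℝ := {t ∈ A | ∃ u ∈ B, (f t, g u) ∈ U} with hP
    set Q : Set ℝ := {u ∈ B | ∃ t ∈ A, (f t, g u) ∈ U} with hQ
    have hsub : φ ⁻¹' U ∩ A ×ˢ B ⊆ P ×ˢ Q := by
      rintro ⟨t, u⟩ ⟨hU, ht, hu⟩
      exact ⟨⟨ht, u, hu, hU⟩, ⟨hu, t, ht, hU⟩⟩
    have hPd : Metric.ediam P ≤ C * Metric.ediam U ^ (s : ℝ) := by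
      refine ediam_le_of_antiHolder hf (fun t ht => ht.1) ?_
      rintro t ⟨-, u, -, h⟩ t' ⟨-, u', -, h'⟩
      exact (le_max_left _ _).trans (Metric.edist_le_ediam_of_mem h h')
    have hQd : Metric.ediam Q ≤ C' * Metric.ediam U ^ (κ : ℝ) := by
      refine ediam_le_of_antiHolder hg (fun t ht => ht.1) ?_
      rintro u ⟨-, t, -, h⟩ u' ⟨-, t', -, h'⟩
      exact (le_max_right _ _).trans (Metric.edist_le_ediam_of_mem h h')
    calc volume (φ ⁻¹' U ∩ A ×ˢ B) ≤ volume (P ×ˢ Q) := measure_mono hsub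
      _ = volume P * volume Q := by rw [Measure.volume_eq_prod, Measure.prod_prod]
      _ ≤ (C * Metric.ediam U ^ (s : ℝ)) * (C' * Metric.ediam U ^ (κ : ℝ)) :=
          mul_le_mul' ((Real.volume_le_diam _).trans hPd) ((Real.volume_le_diam _).trans hQd)
      _ = _ := by
          rw [NNReal.coe_add, ENNReal.rpow_add_of_nonneg _ _ s.coe_nonneg κ.coe_nonneg,
            ENNReal.coe_mul]
          ring
  have hc0 : ((C * C' : ℝ≥0) : ℝ≥0∞) ≠ 0 := by simp [hC, hC']
  have hle : ((C * C' : ℝ≥0) : ℝ≥0∞)⁻¹ • ν ≤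
      OuterMeasure.mkMetric fun d => d ^ ((s + κ : ℝ≥0) : ℝ) := by
    refine OuterMeasure.le_mkMetric _ _ 1 one_pos fun U _ => ?_
    calc ((C * C' : ℝ≥0) : ℝ≥0∞)⁻¹ • ν U
        ≤ ((C * C' : ℝ≥0) : ℝ≥0∞)⁻¹ *
          ((C * C' : ℝ≥0) * Metric.ediam U ^ ((s + κ : ℝ≥0) : ℝ)) := by
            rw [smul_eq_mul]; gcongr; exact key U
      _ = Metric.ediam U ^ ((s + κ : ℝ≥0) : ℝ) := by
            rw [← mul_assoc, ENNReal.inv_mul_cancel hc0 ENNReal.coe_ne_top, one_mul]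
  have hEz : (((C * C' : ℝ≥0) : ℝ≥0∞)⁻¹ • ν) E = 0 := by
    refine le_antisymm ((hle E).trans ?_) zero_le
    rw [OuterMeasure.coe_mkMetric]
    exact h0.le
  have hνE : ν E = 0 := by
    have : ((C * C' : ℝ≥0) : ℝ≥0∞)⁻¹ * ν E = 0 := hEz
    simpa [ENNReal.mul_eq_top] using this
  have hsub : φ ⁻¹' E ∩ A ×ˢ B = A ×ˢ B :=
    inter_eq_right.2 fun p hp => hE p.1 hp.1 p.2 hp.2
  rw [hν, hsub, Measure.volume_eq_prod, Measure.prod_prod, mul_eq_zero] at hνE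
  exact hνE.elim hA hB

/-! ### An expanding parametrization of the Cantor set -/

/-- Ternary expansions in the digits `0` and `2` that first differ at place `n` represent points at
distance at least `3 ^ (-(n + 1))`. -/
theorem inv_three_pow_le_abs_ofDigits_sub {a b : ℕ → Bool} {n : ℕ} (hn : ∀ i < n, a i = b i)
    (hab : a n ≠ b n) :
    ((3 : ℝ) ^ (n + 1))⁻¹ ≤ |Real.ofDigits (fun i => cond (a i) (2 : Fin 3) 0) -
      Real.ofDigits (fun i => cond (b i) (2 : Fin 3) 0)| := by
  wlog h : a n = true ∧ b n = false generalizing a b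
  · rw [abs_sub_comm]
    exact this (fun i hi => (hn i hi).symm) hab.symm (by
      cases ha : a n <;> cases hb : b n <;> simp_all)
  have hsum : ∑ x ∈ Finset.range n, Real.ofDigitsTerm (fun i => cond (a i) (2 : Fin 3) 0) x =
      ∑ x ∈ Finset.range n, Real.ofDigitsTerm (fun i => cond (b i) (2 : Fin 3) 0) x :=
    Finset.sum_congr rfl fun i hi => by
      simp [Real.ofDigitsTerm, hn i (Finset.mem_range.1 hi)]
  rw [Real.ofDigits_eq_sum_add_ofDigits (fun i => cond (a i) (2 : Fin 3) 0) (n + 1),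
    Real.ofDigits_eq_sum_add_ofDigits (fun i => cond (b i) (2 : Fin 3) 0) (n + 1),
    Finset.sum_range_succ, Finset.sum_range_succ, hsum]
  refine le_trans ?_ (le_abs_self _)
  have h1 := Real.ofDigits_nonneg fun i => cond (a (i + (n + 1))) (2 : Fin 3) 0
  have h2 := Real.ofDigits_le_one fun i => cond (b (i + (n + 1))) (2 : Fin 3) 0
  have h3 : (0 : ℝ) < (3 ^ (n + 1))⁻¹ := by positivity
  simp only [Real.ofDigitsTerm, h.1, h.2, cond_true, cond_false]
  have h4 : (((2 : Fin 3) : ℕ) : ℝ) = 2 := by norm_num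
  have h5 : (((0 : Fin 3) : ℕ) : ℝ) = 0 := by norm_num
  rw [h4, h5]
  push_cast
  nlinarith

/-- The similarity dimension of the Cantor set. -/
noncomputable abbrev cantorDim : ℝ := Real.log 2 / Real.log 3

theorem cantorDim_pos : 0 < cantorDim := by
  have := Real.log_pos (show (1 : ℝ) < 2 by norm_num)
  have := Real.log_pos (show (1 : ℝ) < 3 by norm_num)
  unfold cantorDim
  positivity

theorem three_pow_rpow_cantorDim (n : ℕ) : ((3 : ℝ) ^ n) ^ cantorDim = 2 ^ n := by
  have h3 := Real.log_pos (show (1 : ℝ) < 3 by norm_num)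
  have h : (3 : ℝ) ^ cantorDim = 2 := by
    rw [Real.rpow_def_of_pos (by norm_num), cantorDim, mul_div_cancel₀ _ h3.ne',
      Real.exp_log (by norm_num)]
  rw [← Real.rpow_natCast, ← Real.rpow_mul (by norm_num), mul_comm, Real.rpow_mul (by norm_num), h,
    Real.rpow_natCast]

/-- An inverse branch of the Cantor function, scaled into the left third `[0, 1/3]` of the Cantor
set: the binary digits of `t` become ternary digits `0` and `2`. It expands distances in the sense
of a Hölder condition on its inverse. -/
theorem exists_antiHolder_cantorSet :
    ∃ g : ℝ → ℝ, (∀ t ∈ Ico (0 : ℝ) 1, g t ∈ cantorSet ∧ g t ∈ Icc (0 : ℝ) (1 / 2)) ∧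
      ∀ t ∈ Ico (0 : ℝ) 1, ∀ t' ∈ Ico (0 : ℝ) 1, |t - t'| ≤ 4 * |g t - g t'| ^ cantorDim := by
  let β : ℝ → ℕ → Bool := fun t i => decide (Real.digits t 2 i = 1)
  let h : ℝ → ℝ := fun t => Real.ofDigits fun i => cond (β t i) (2 : Fin 3) 0
  have hh (t : ℝ) : h t ∈ cantorSet := ofDigits_bool_to_fin_three_mem_cantorSet _
  refine ⟨fun t => h t / 3, fun t _ => ⟨?_, ?_⟩, fun t ht t' ht' => ?_⟩
  · rw [cantorSet_eq_union_halves]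
    exact Or.inl ⟨h t, hh t, rfl⟩
  · have := cantorSet_subset_unitInterval (hh t)
    constructor <;> linarith [this.1, this.2]
  · by_cases hd : Real.digits t 2 = Real.digits t' 2
    · have : t = t' := by
        rw [← Real.ofDigits_digits one_lt_two ht, hd, Real.ofDigits_digits one_lt_two ht']
      rw [this]
      simp
      positivity
    · have hex : ∃ n, Real.digits t 2 n ≠ Real.digits t' 2 n := Function.ne_iff.1 hd
      obtain ⟨n, hn, hmin⟩ : ∃ n, Real.digits t 2 n ≠ Real.digits t' 2 n ∧
          ∀ i < n, Real.digits t 2 i = Real.digits t' 2 i :=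
        ⟨Nat.find hex, Nat.find_spec hex, fun i hi => by simpa using Nat.find_min hex hi⟩
      have h1 : |t - t'| ≤ ((2 : ℝ) ^ n)⁻¹ := by
        have := Real.abs_ofDigits_sub_ofDigits_le hmin
        rwa [Real.ofDigits_digits one_lt_two ht, Real.ofDigits_digits one_lt_two ht'] at this
      have h2 : ((3 : ℝ) ^ (n + 1))⁻¹ ≤ |h t - h t'| := by
        refine inv_three_pow_le_abs_ofDigits_sub (fun i hi => ?_) ?_
        · simp only [β, hmin i hi]
        · intro hβ
          simp only [β] at hβ
          generalize Real.digits t 2 n = u at hn hβ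
          generalize Real.digits t' 2 n = v at hn hβ
          revert hn hβ
          revert u v
          decide
      have h3 : ((3 : ℝ) ^ (n + 2))⁻¹ ≤ |h t / 3 - h t' / 3| := by
        rw [← sub_div, abs_div, abs_of_pos (show (0 : ℝ) < 3 by norm_num), pow_succ, mul_inv]
        rw [div_eq_mul_inv]
        gcongr
      calc |t - t'| ≤ ((2 : ℝ) ^ n)⁻¹ := h1
        _ = 4 * (((3 : ℝ) ^ (n + 2))⁻¹) ^ cantorDim := by
            rw [Real.inv_rpow (by positivity), three_pow_rpow_cantorDim, pow_add, mul_inv]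
            ring
        _ ≤ _ := by
            gcongr

/-! ### Expanding parametrizations from trees of intervals -/

/-- A tree of nested intervals on the line. The interval of generation `k` and index `b < M k` has
centre `z k b` and radius `r k`; its `m k` children are those of index `b'` with `b' / m k = b`.
A number `t ∈ [0, 1)` is sent to the point common to the intervals of index `⌊t * M k⌋₊`. If
siblings are spread evenly over their parent and `M k ≥ r k ^ (-s) / A`, then the inverse of this
map is Hölder of exponent `s`. -/
theorem exists_antiHolder_of_tree {m M : ℕ → ℕ} {z : ℕ → ℕ → ℝ} {r ε : ℕ → ℝ} {s A c : ℝ}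
    (hM0 : M 0 = 1) (hM : ∀ k, M (k + 1) = M k * m k) (hm : ∀ k, 2 ≤ m k) (hr : ∀ k, 0 < r k)
    (hnest : ∀ k, ∀ b < M (k + 1), |z (k + 1) b - z k (b / m k)| + r (k + 1) ≤ r k)
    (hsep : ∀ k b b', b < b' → b' < M (k + 1) → b / m k = b' / m k →
      ((b' : ℝ) - b) * ε k ≤ |z (k + 1) b' - z (k + 1) b|)
    (hε : ∀ k, 4 * r (k + 1) ≤ ε k) (hc : 0 < c) (hcr : ∀ k, c * r k ≤ m k * ε k)
    (hs0 : 0 < s) (hs1 : s ≤ 1) (hA : ∀ k, 1 ≤ A * M k * r k ^ s) :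
    ∃ (f : ℝ → ℝ) (C : ℝ), 0 < C ∧
      (∀ t ∈ Ico (0 : ℝ) 1, ∀ k, |f t - z k ⌊t * M k⌋₊| ≤ r k) ∧
      ∀ t ∈ Ico (0 : ℝ) 1, ∀ t' ∈ Ico (0 : ℝ) 1, |t - t'| ≤ C * |f t - f t'| ^ s := by
  have hMge (k : ℕ) : 2 ^ k ≤ M k := by
    induction k with
    | zero => simp [hM0]
    | succ k ih => rw [hM, pow_succ]; exact Nat.mul_le_mul ih (hm k)
  have hMpos (k : ℕ) : (0 : ℝ) < M k := by
    exact_mod_cast (Nat.two_pow_pos k).trans_le (hMge k)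
  have hmpos (k : ℕ) : (0 : ℝ) < m k := by
    exact_mod_cast lt_of_lt_of_le two_pos (hm k)
  have hApos : 0 < A := by
    by_contra! h
    have := hA 0
    have := Real.rpow_pos_of_pos (hr 0) s
    have := mul_nonneg (hMpos 0).le this.le
    nlinarith
  have hlt {t : ℝ} (ht : t ∈ Ico (0 : ℝ) 1) (k : ℕ) : ⌊t * M k⌋₊ < M k := by
    rw [Nat.floor_lt (mul_nonneg ht.1 (hMpos k).le)]
    exact mul_lt_of_lt_one_left (hMpos k) ht.2
  have hdiv (t : ℝ) (k : ℕ) : ⌊t * M (k + 1)⌋₊ / m k = ⌊t * M k⌋₊ := by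
    rw [← Nat.floor_div_natCast, hM, Nat.cast_mul, ← mul_assoc,
      mul_div_cancel_right₀ _ (hmpos k).ne']
  let f : ℝ → ℝ := fun t => ⨆ k, (z k ⌊t * M k⌋₊ - r k)
  have hf : ∀ t ∈ Ico (0 : ℝ) 1, ∀ k, |f t - z k ⌊t * M k⌋₊| ≤ r k := by
    intro t ht k
    have hanti : Antitone fun k => Icc (z k ⌊t * M k⌋₊ - r k) (z k ⌊t * M k⌋₊ + r k) := by
      refine antitone_nat_of_succ_le fun k => ?_
      have h := hnest k _ (hlt ht (k + 1))
      rw [hdiv] at h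
      have h1 := le_abs_self (z (k + 1) ⌊t * M (k + 1)⌋₊ - z k ⌊t * M k⌋₊)
      have h2 := neg_le_abs (z (k + 1) ⌊t * M (k + 1)⌋₊ - z k ⌊t * M k⌋₊)
      exact Icc_subset_Icc (by linarith) (by linarith)
    have := mem_iInter.1 (ciSup_mem_iInter_Icc_of_antitone_Icc hanti
      fun k => by linarith [hr k]) k
    rw [abs_le]
    constructor <;> linarith [this.1, this.2]
  refine ⟨f, 2 * A * (2 / c) ^ s, by positivity, hf, fun t ht t' ht' => ?_⟩
  wlog htt : t < t' generalizing t t'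
  · rcases (not_lt.1 htt).eq_or_lt with rfl | h
    · simp only [sub_self, abs_zero]
      positivity
    · rw [abs_sub_comm, abs_sub_comm (f t)]
      exact this t' ht' t ht h
  have hex : ∃ k, ⌊t * M k⌋₊ ≠ ⌊t' * M k⌋₊ := by
    obtain ⟨k, hk⟩ := pow_unbounded_of_one_lt (1 / (t' - t)) one_lt_two
    refine ⟨k, fun h => ?_⟩
    have h1 : 1 < (t' - t) * M k := by
      rw [div_lt_iff₀ (sub_pos.2 htt)] at hk
      have : (2 : ℝ) ^ k ≤ M k := by exact_mod_cast hMge k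
      nlinarith [sub_pos.2 htt]
    have h2 := Nat.floor_le (mul_nonneg ht.1 (hMpos k).le)
    have h3 := Nat.lt_floor_add_one (t' * M k)
    rw [← h] at h3
    linarith
  -- `K = k + 1` is the first generation at which `t` and `t'` lie in different intervals.
  obtain ⟨K, hK, hmin⟩ : ∃ K, ⌊t * M K⌋₊ ≠ ⌊t' * M K⌋₊ ∧ ∀ i < K, ⌊t * M i⌋₊ = ⌊t' * M i⌋₊ :=
    ⟨Nat.find hex, Nat.find_spec hex, fun i hi => by simpa using Nat.find_min hex hi⟩
  obtain _ | k := K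
  · exact absurd (by rw [Nat.floor_eq_zero.2 (by simpa [hM0] using ht.2),
      Nat.floor_eq_zero.2 (by simpa [hM0] using ht'.2)]) hK
  have hk := hmin k k.lt_succ_self
  have hbt := hf t ht (k + 1)
  have hbt' := hf t' ht' (k + 1)
  have hdt := hdiv t k
  have hdt' := hdiv t' k
  have hlt' := hlt ht' (k + 1)
  have hle : ⌊t * M (k + 1)⌋₊ ≤ ⌊t' * M (k + 1)⌋₊ := by
    gcongr
  have hfl := Nat.floor_le (mul_nonneg ht.1 (hMpos (k + 1)).le)
  have hfl' := Nat.lt_floor_add_one (t' * M (k + 1))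
  generalize ⌊t * M (k + 1)⌋₊ = b at *
  generalize ⌊t' * M (k + 1)⌋₊ = b' at *
  have hbb : b < b' := lt_of_le_of_ne hle hK
  have hdd : b / m k = b' / m k := by rw [hdt, hdt', hk]
  have hs := hsep k b b' hbb hlt' hdd
  have hj1 : (1 : ℝ) ≤ (b' : ℝ) - b := by
    have : (b : ℝ) + 1 ≤ b' := by exact_mod_cast hbb
    linarith
  have hjm : (b' : ℝ) - b ≤ m k := by
    have h1 := Nat.div_add_mod b (m k)
    have h2 := Nat.div_add_mod b' (m k)
    have h3 := Nat.mod_lt b' (lt_of_lt_of_le two_pos (hm k))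
    rw [hdd] at h1
    have : b' ≤ b + m k := by omega
    have : (b' : ℝ) ≤ b + m k := by exact_mod_cast this
    linarith
  set j : ℝ := (b' : ℝ) - b with hj
  have hεk : 0 < ε k := by linarith [hε k, hr (k + 1)]
  -- The two centres are `j ε` apart, and both points are within `r (k + 1) ≤ ε / 4` of theirs.
  have hD : j * ε k / 2 ≤ |f t - f t'| := by
    have h1 : |z (k + 1) b' - z (k + 1) b| ≤
        |f t - f t'| + |f t - z (k + 1) b| + |f t' - z (k + 1) b'| := by
      have h2 : z (k + 1) b' - z (k + 1) b =
        (f t - z (k + 1) b) - (f t - f t') - (f t' - z (k + 1) b') := by ring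
      rw [h2]
      linarith [abs_sub (f t - z (k + 1) b - (f t - f t')) (f t' - z (k + 1) b'),
        abs_sub (f t - z (k + 1) b) (f t - f t')]
    have := hε k
    nlinarith
  have hjpos : 0 < j := by linarith
  rw [abs_sub_comm, abs_of_pos (sub_pos.2 htt)]
  -- With `j` the difference of the indices, `t' - t ≤ (j + 1) / M (k + 1)`; since `j / m ≤ 1`, it
  -- is bounded by its `s`-th power, and `j r / m` is of the order of the distance `j ε`.
  calc t' - t ≤ 2 * (j / m k) / M k := by
        rw [hM] at hfl hfl'
        push_cast at hfl hfl'
        have := hMpos k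
        have := hmpos k
        rw [mul_div_assoc', div_div, le_div_iff₀ (by positivity)]
        nlinarith
    _ ≤ 2 * (j / m k) * (A * r k ^ s) := by
        rw [div_le_iff₀ (hMpos k), mul_assoc]
        have := hA k
        have h0 : 0 ≤ 2 * (j / m k) := by have := hmpos k; positivity
        nlinarith
    _ ≤ 2 * (j / m k) ^ s * (A * r k ^ s) := by
        have h0 : 0 < j / m k := div_pos hjpos (hmpos k)
        have h1 : j / m k ≤ (j / m k) ^ s := by
          have := Real.rpow_le_rpow_of_exponent_ge h0 ((div_le_one (hmpos k)).2 hjm) hs1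
          rwa [Real.rpow_one] at this
        have := Real.rpow_pos_of_pos (hr k) s
        gcongr
    _ = 2 * A * (j / m k * r k) ^ s := by
        rw [Real.mul_rpow (div_pos hjpos (hmpos k)).le (hr k).le]; ring
    _ ≤ 2 * A * (2 / c * |f t - f t'|) ^ s := by
        have h1 : j / m k * r k ≤ 2 / c * |f t - f t'| := by
          rw [div_mul_eq_mul_div, div_mul_eq_mul_div, div_le_div_iff₀ (hmpos k) hc]
          have := hcr k
          have := hmpos k
          calc j * r k * c = j * (c * r k) := by ring
            _ ≤ j * (m k * ε k) := by gcongr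
            _ = 2 * (j * ε k / 2) * m k := by ring
            _ ≤ _ := by gcongr
        have : 0 ≤ j / m k * r k := by have := hmpos k; have := hr k; positivity
        gcongr
    _ = _ := by
        rw [Real.mul_rpow (by positivity) (abs_nonneg _)]; ring

/-! ### Counting rationals in short intervals -/

theorem length_le_sum_of_subset_biUnion_closedBall {ι : Type*} {a b : ℝ} (F : Finset ι)
    (x ρ : ι → ℝ) (hρ : ∀ i ∈ F, 0 ≤ ρ i) (h : Icc a b ⊆ ⋃ i ∈ F, Metric.closedBall (x i) (ρ i)) :
    b - a ≤ ∑ i ∈ F, 2 * ρ i := by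
  have h1 : ENNReal.ofReal (b - a) ≤ ENNReal.ofReal (∑ i ∈ F, 2 * ρ i) := by
    rw [← Real.volume_Icc, ENNReal.ofReal_sum_of_nonneg fun i hi => by linarith [hρ i hi]]
    refine (measure_mono h).trans ((measure_biUnion_finset_le _ _).trans_eq ?_)
    simp [Real.volume_closedBall]
  exact (ENNReal.ofReal_le_ofReal_iff (Finset.sum_nonneg fun i hi => by linarith [hρ i hi])).1 h1

theorem tendsto_one_add_log_div_atTop :
    Tendsto (fun n : ℕ => (1 + Real.log n) / n) atTop (𝓝 0) := by
  have h1 : Tendsto (fun x : ℝ => (1 + Real.log x) / x) atTop (𝓝 0) := by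
    have h2 := Real.isLittleO_log_id_atTop.tendsto_div_nhds_zero
    have h3 := (tendsto_inv_atTop_zero (𝕜 := ℝ)).add h2
    simp only [add_zero] at h3
    refine h3.congr fun x => ?_
    simp [add_div, id]
  exact h1.comp tendsto_natCast_atTop_atTop

/-- Quantitative density of the rationals of denominator at most `n`. By Dirichlet's theorem the
balls of radius `1 / (n q)` about the `p / q` with `q ≤ n` cover an interval of length `r`; those
with `q ≤ n / 16` cover at most half of it, so there must be of the order of `n ^ 2 r` rationals of
larger denominator. -/
theorem eventually_exists_finset_rat {r : ℝ} (hr : 0 < r) :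
    ∀ᶠ n : ℕ in atTop, ∀ z : ℝ, ∃ S : Finset ℚ, (∀ w ∈ S, w.den ≤ n ∧ |(w : ℝ) - z| ≤ r) ∧
      r * n ^ 2 / 64 ≤ S.card := by
  have hlog : ∀ᶠ n : ℕ in atTop, (1 + Real.log n) / n < r / 8 :=
    tendsto_one_add_log_div_atTop.eventually_lt_const (by positivity)
  have hinv : ∀ᶠ n : ℕ in atTop, 2 / r ≤ (n : ℝ) :=
    tendsto_natCast_atTop_atTop.eventually_ge_atTop _
  filter_upwards [hlog, hinv, eventually_gt_atTop 0] with n hn hnr hn0 z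
  have hnpos : (0 : ℝ) < n := by exact_mod_cast hn0
  -- `P q` holds the numerators of the fractions of denominator `q` within `r` of `z`.
  let P : ℕ → Finset ℤ := fun q => Finset.Icc ⌈q * (z - r)⌉ ⌊q * (z + r)⌋
  have hP (w : ℚ) (hw : |(w : ℝ) - z| ≤ r) : w.num ∈ P w.den := by
    have hd : (0 : ℝ) < w.den := by exact_mod_cast w.den_pos
    have hwd : (w.num : ℝ) = w.den * w := by
      have := Rat.den_mul_eq_num w
      exact_mod_cast this.symm
    rw [abs_le] at hw
    rw [Finset.mem_Icc, Int.ceil_le, Int.le_floor, hwd]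
    constructor <;> gcongr <;> linarith
  have hPcard (q : ℕ) : ((P q).card : ℝ) ≤ 2 * r * q + 1 := by
    have h1 : (0 : ℝ) ≤ 2 * r * q + 1 := by positivity
    rw [Int.card_Icc]
    have h2 : (((⌊q * (z + r)⌋ + 1 - ⌈q * (z - r)⌉ : ℤ).toNat : ℤ) : ℝ) ≤ 2 * r * q + 1 := by
      rw [Int.toNat_eq_max]
      push_cast
      refine max_le ?_ h1
      linarith [Int.floor_le (q * (z + r)), Int.le_ceil (q * (z - r))]
    exact_mod_cast h2
  let S : Finset ℚ := ((Finset.Icc 1 n).sigma P).image (fun x => (x.2 / x.1 : ℚ)) |>.filter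
    fun w => w.den ≤ n ∧ n ≤ 16 * w.den ∧ |(w : ℝ) - z| ≤ r
  have hS (w : ℚ) (h1 : w.den ≤ n) (h2 : n ≤ 16 * w.den) (h3 : |(w : ℝ) - z| ≤ r) : w ∈ S := by
    refine Finset.mem_filter.2 ⟨Finset.mem_image.2 ⟨⟨w.den, w.num⟩, ?_, ?_⟩, h1, h2, h3⟩
    · exact Finset.mem_sigma.2 ⟨Finset.mem_Icc.2 ⟨w.den_pos, h1⟩, hP w h3⟩
    · exact Rat.num_div_den w
  refine ⟨S, fun w hw => ⟨(Finset.mem_filter.1 hw).2.1, (Finset.mem_filter.1 hw).2.2.2⟩, ?_⟩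
  -- The covering balls about fractions of denominator at most `n / 16` are indexed by `T`, the
  -- others by `S`.
  let T : Finset (Σ _ : ℕ, ℤ) := (Finset.Icc 1 (n / 16)).sigma P
  let x : (Σ _ : ℕ, ℤ) ⊕ ℚ → ℝ := Sum.elim (fun y => y.2 / y.1) (fun w => w)
  let ρ : (Σ _ : ℕ, ℤ) ⊕ ℚ → ℝ := Sum.elim (fun y => 1 / (n * y.1)) (fun _ => 16 / n ^ 2)
  have hcover : Icc (z - r / 2) (z + r / 2) ⊆
      ⋃ i ∈ T.disjSum S, Metric.closedBall (x i) (ρ i) := by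
    intro y hy
    obtain ⟨w, hw, hwn⟩ := Real.exists_rat_abs_sub_le_and_den_le y hn0
    have hd : (1 : ℝ) ≤ w.den := by exact_mod_cast w.den_pos
    have hwn' : (w.den : ℝ) ≤ n := by exact_mod_cast hwn
    have hw1 : |y - w| ≤ 1 / (n * w.den) := hw.trans (by gcongr; linarith)
    have hw2 : 1 / (n * w.den) ≤ r / 2 := by
      rw [div_le_div_iff₀ (by positivity) two_pos]
      rw [div_le_iff₀ hr] at hnr
      nlinarith
    have hwz : |(w : ℝ) - z| ≤ r := by
      have h1 := abs_le.1 (hw1.trans hw2)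
      rw [abs_le]
      constructor <;> linarith [h1.1, h1.2, hy.1, hy.2]
    rw [mem_iUnion₂]
    by_cases h16 : n ≤ 16 * w.den
    · refine ⟨Sum.inr w, Finset.inr_mem_disjSum.2 (hS w hwn h16 hwz), ?_⟩
      rw [Metric.mem_closedBall, Real.dist_eq]
      refine hw1.trans ?_
      change 1 / (n * (w.den : ℝ)) ≤ 16 / n ^ 2
      have : (n : ℝ) ≤ 16 * w.den := by exact_mod_cast h16
      rw [div_le_div_iff₀ (by positivity) (by positivity)]
      nlinarith
    · refine ⟨Sum.inl ⟨w.den, w.num⟩, Finset.inl_mem_disjSum.2 (Finset.mem_sigma.2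
        ⟨Finset.mem_Icc.2 ⟨w.den_pos, by dsimp only; omega⟩, hP w hwz⟩), ?_⟩
      rw [Metric.mem_closedBall, Real.dist_eq]
      have : x (Sum.inl ⟨w.den, w.num⟩) = w := (Rat.cast_def w).symm
      rw [this]
      exact hw1
  have hlen := length_le_sum_of_subset_biUnion_closedBall _ x ρ (fun i _ => by
    rcases i with i | i <;> simp only [ρ, Sum.elim_inl, Sum.elim_inr] <;> positivity) hcover
  rw [Finset.sum_disjSum] at hlen
  have hsumS : ∑ w ∈ S, 2 * ρ (Sum.inr w) = S.card * (32 / n ^ 2) := by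
    simp only [ρ, Sum.elim_inr, Finset.sum_const, nsmul_eq_mul]
    ring
  have hsumT : ∑ y ∈ T, 2 * ρ (Sum.inl y) ≤ r / 2 := by
    have h1 : ∑ y ∈ T, 2 * ρ (Sum.inl y) =
        ∑ q ∈ Finset.Icc 1 (n / 16), ((P q).card : ℝ) * (2 * (1 / (n * q))) := by
      simp only [T, Finset.sum_sigma, ρ, Sum.elim_inl, Finset.sum_const, nsmul_eq_mul]
    have h2 : ∀ q ∈ Finset.Icc 1 (n / 16), ((P q).card : ℝ) * (2 * (1 / (n * q))) ≤
        4 * r / n + 2 / n * (q : ℝ)⁻¹ := by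
      intro q hq
      have hq0 : (0 : ℝ) < q := by exact_mod_cast (Finset.mem_Icc.1 hq).1
      calc ((P q).card : ℝ) * (2 * (1 / (n * q))) ≤ (2 * r * q + 1) * (2 * (1 / (n * q))) := by
            gcongr; exact hPcard q
        _ = _ := by field_simp; ring
    have h3 : ∑ q ∈ Finset.Icc 1 (n / 16), (q : ℝ)⁻¹ ≤ 1 + Real.log n := by
      calc ∑ q ∈ Finset.Icc 1 (n / 16), (q : ℝ)⁻¹ ≤ ∑ q ∈ Finset.Icc 1 n, (q : ℝ)⁻¹ :=
            Finset.sum_le_sum_of_subset_of_nonneg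
              (Finset.Icc_subset_Icc_right (Nat.div_le_self _ _)) fun _ _ _ => by positivity
        _ = (harmonic n : ℝ) := by rw [harmonic_eq_sum_Icc]; push_cast; rfl
        _ ≤ _ := harmonic_le_one_add_log n
    have h4 : ((n / 16 : ℕ) : ℝ) ≤ n / 16 := by exact_mod_cast Nat.cast_div_le (α := ℝ)
    calc ∑ y ∈ T, 2 * ρ (Sum.inl y)
        ≤ ∑ q ∈ Finset.Icc 1 (n / 16), (4 * r / n + 2 / n * (q : ℝ)⁻¹) :=
          h1.trans_le (Finset.sum_le_sum h2)
      _ = (n / 16 : ℕ) * (4 * r / n) + 2 / n * ∑ q ∈ Finset.Icc 1 (n / 16), (q : ℝ)⁻¹ := by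
          rw [Finset.sum_add_distrib, ← Finset.mul_sum]; simp
      _ ≤ n / 16 * (4 * r / n) + 2 / n * (1 + Real.log n) := by gcongr
      _ = r / 4 + 2 * ((1 + Real.log n) / n) := by field_simp; ring
      _ ≤ r / 2 := by linarith
  rw [hsumS] at hlen
  have h5 : r / 2 ≤ S.card * (32 / n ^ 2) := by linarith
  rw [mul_div_assoc', le_div_iff₀ (by positivity)] at h5
  linarith

/-- Distinct rationals of denominator at most `n` are at distance at least `1 / n ^ 2`. -/
theorem inv_sq_le_sub_of_den_le {n : ℕ} {v w : ℚ} (hv : v.den ≤ n) (hw : w.den ≤ n)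
    (h : v < w) : 1 / (n : ℝ) ^ 2 ≤ w - v := by
  have h1 := Rat.num_div_den v
  have h2 := Rat.num_div_den w
  have hdv : (0 : ℚ) < v.den := by exact_mod_cast v.den_pos
  have hdw : (0 : ℚ) < w.den := by exact_mod_cast w.den_pos
  have hn : (0 : ℚ) < n := by exact_mod_cast v.den_pos.trans_le hv
  have h3 : v.num * w.den + 1 ≤ w.num * v.den := by
    rw [Rat.lt_iff] at h
    exact h
  have h4 : 1 / (n : ℚ) ^ 2 ≤ w - v := by
    rw [← h1, ← h2, div_sub_div _ _ hdw.ne' hdv.ne']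
    have h5 : (v.num * w.den + 1 : ℚ) ≤ w.num * v.den := by exact_mod_cast h3
    have h6 : (w.den * v.den : ℚ) ≤ n ^ 2 := by
      rw [sq]
      exact mul_le_mul (by exact_mod_cast hw) (by exact_mod_cast hv) hdv.le hn.le
    have h7 : (0 : ℚ) < w.den * v.den := by positivity
    calc 1 / (n : ℚ) ^ 2 ≤ 1 / (w.den * v.den) := by gcongr
      _ ≤ _ := by gcongr; linarith
  have h8 := (Rat.cast_le (K := ℝ)).2 h4
  push_cast at h8
  exact h8

/-- Rationals of denominator at most `n`, listed in increasing order, are at distance at least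
`1 / n ^ 2` times the difference of their positions. -/
theorem exists_enum_of_finset_rat {n m : ℕ} {S : Finset ℚ} (hS : ∀ w ∈ S, w.den ≤ n)
    (hm : m ≤ S.card) : ∃ g : ℕ → ℚ, (∀ j < m, g j ∈ S) ∧
      ∀ i j, i < j → j < m → ((j : ℝ) - i) * (1 / (n : ℝ) ^ 2) ≤ g j - g i := by
  let e := S.orderEmbOfFin rfl
  let g : ℕ → ℚ := fun j => if h : j < S.card then e ⟨j, h⟩ else 0
  have hg {j : ℕ} (h : j < S.card) : g j = e ⟨j, h⟩ := dif_pos h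
  have hmem {j : ℕ} (h : j < S.card) : g j ∈ S := by
    rw [hg h]; exact S.orderEmbOfFin_mem rfl _
  refine ⟨g, fun j hj => hmem (hj.trans_le hm), fun i j hij hj => ?_⟩
  induction j, hij using Nat.le_induction with
  | base =>
    have h1 : i + 1 < S.card := hj.trans_le hm
    have h2 : i < S.card := by omega
    have := inv_sq_le_sub_of_den_le (hS _ (hmem h2)) (hS _ (hmem h1)) (by
      rw [hg h1, hg h2, OrderEmbedding.lt_iff_lt]; exact Fin.mk_lt_mk.2 i.lt_succ_self)
    push_cast
    linarith
  | succ j hij ih =>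
    have h1 : j + 1 < S.card := hj.trans_le hm
    have h2 : j < S.card := by omega
    have := inv_sq_le_sub_of_den_le (hS _ (hmem h2)) (hS _ (hmem h1)) (by
      rw [hg h1, hg h2, OrderEmbedding.lt_iff_lt]; exact Fin.mk_lt_mk.2 j.lt_succ_self)
    have := ih (by omega)
    push_cast
    linarith

/-! ### A Cantor set of well approximable numbers -/

/-- One step of the construction: around any centre, `m` well separated rationals of denominator at
most `n`. Since `τ s < 2`, a large `n` makes `m`, which is of the order of `n ^ 2 r`, exceed the
`(-s)`-th power of the next radius `n ^ (-τ) / 4`. -/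
theorem exists_children {s τ r M : ℝ} (hτ : 2 ≤ τ) (hs : 0 < s) (hsτ : τ * s < 2) (hr : 0 < r)
    (hM : 1 ≤ M) : ∃ (n m : ℕ) (child : ℝ → ℕ → ℚ), 0 < n ∧ 2 ≤ m ∧ (n : ℝ) ^ (-τ) / 4 ≤ r / 2 ∧
      (∀ z, ∀ j < m, (child z j).den ≤ n ∧ |(child z j : ℝ) - z| ≤ r / 2) ∧
      (∀ z i j, i < j → j < m →
        ((j : ℝ) - i) * (1 / (n : ℝ) ^ 2) ≤ child z j - child z i) ∧
      1 / 128 * r ≤ m * (1 / (n : ℝ) ^ 2) ∧ 1 ≤ M * m * ((n : ℝ) ^ (-τ) / 4) ^ s := by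
  have hs1 : s ≤ 1 := by nlinarith
  have h1 : ∀ᶠ n : ℕ in atTop, (n : ℝ) ^ (-τ) < 2 * r :=
    ((tendsto_rpow_neg_atTop (by linarith)).comp tendsto_natCast_atTop_atTop).eventually_lt_const
      (by positivity)
  -- Large enough for the mass condition, as `m ≥ r n ^ 2 / 128` and `4 ^ (-s) ≥ 1 / 4`.
  have h2 : ∀ᶠ n : ℕ in atTop, 512 / r ≤ (n : ℝ) ^ (2 - τ * s) :=
    ((tendsto_rpow_atTop (by linarith)).comp tendsto_natCast_atTop_atTop).eventually_ge_atTop _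
  -- Large enough for at least two children.
  have h3 : ∀ᶠ n : ℕ in atTop, 128 / r < (n : ℝ) ^ (2 : ℝ) :=
    ((tendsto_rpow_atTop (by norm_num)).comp tendsto_natCast_atTop_atTop).eventually_gt_atTop _
  obtain ⟨n, hn1, hn2, hn3, hn0, hn⟩ := (h1.and <| h2.and <| h3.and <| (eventually_gt_atTop 0).and
    (eventually_exists_finset_rat (half_pos hr))).exists
  have hnpos : (0 : ℝ) < n := by exact_mod_cast hn0
  rw [Real.rpow_two, div_lt_iff₀ hr] at hn3
  rw [div_le_iff₀ hr] at hn2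
  choose S hS hcard using hn
  set m : ℕ := ⌈r / 2 * n ^ 2 / 64⌉₊ with hm
  have hmge : r / 2 * n ^ 2 / 64 ≤ m := Nat.le_ceil _
  have hmle (z : ℝ) : m ≤ (S z).card := Nat.ceil_le.2 (hcard z)
  choose g hg hsep using fun z => exists_enum_of_finset_rat (fun w hw => (hS z w hw).1) (hmle z)
  refine ⟨n, m, g, hn0, ?_, by linarith, fun z j hj => hS z _ (hg z j hj), hsep, ?_, ?_⟩
  · have : (1 : ℝ) < m := by linarith
    exact_mod_cast this
  · rw [mul_one_div, le_div_iff₀ (by positivity)]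
    linarith
  · have h4 : (1 / 4 : ℝ) ≤ (1 / 4 : ℝ) ^ s := by
      simpa using Real.rpow_le_rpow_of_exponent_ge (x := 1 / 4) (by norm_num) (by norm_num) hs1
    have h5 : (n : ℝ) ^ 2 * ((n : ℝ) ^ (-τ)) ^ s = (n : ℝ) ^ (2 - τ * s) := by
      rw [← Real.rpow_mul hnpos.le, ← Real.rpow_natCast, ← Real.rpow_add hnpos]
      congr 1
      push_cast
      ring
    have h6 : (0 : ℝ) < ((n : ℝ) ^ (-τ)) ^ s := by positivity
    rw [div_eq_mul_one_div, Real.mul_rpow (by positivity) (by norm_num)]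
    calc (1 : ℝ) ≤ 1 / 512 * ((n : ℝ) ^ (2 - τ * s) * r) := by linarith
      _ = r / 2 * n ^ 2 / 64 * (((n : ℝ) ^ (-τ)) ^ s * (1 / 4)) := by rw [← h5]; ring
      _ ≤ m * (((n : ℝ) ^ (-τ)) ^ s * (1 / 4 : ℝ) ^ s) := by gcongr
      _ ≤ M * (m * (((n : ℝ) ^ (-τ)) ^ s * (1 / 4 : ℝ) ^ s)) :=
          le_mul_of_one_le_left (by positivity) hM
      _ = _ := by ring

/-- A parametrized Cantor set of `τ`-approximable numbers, of dimension at least `s`: the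
parametrization is injective and its inverse is Hölder of exponent `s`. -/
theorem exists_antiHolder_approximable {s τ : ℝ} (hτ : 2 ≤ τ) (hs : 0 < s) (hsτ : τ * s < 2) :
    ∃ (f : ℝ → ℝ) (C : ℝ), 0 < C ∧
      (∀ t ∈ Ico (0 : ℝ) 1, f t ∈ Icc (0 : ℝ) (1 / 2) ∧
        ∀ δ > 0, ∃ w : ℚ, |f t - w| < (w.den : ℝ) ^ (-τ) ∧ |f t - w| < δ) ∧
      ∀ t ∈ Ico (0 : ℝ) 1, ∀ t' ∈ Ico (0 : ℝ) 1, |t - t'| ≤ C * |f t - f t'| ^ s := by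
  have hs1 : s ≤ 1 := by nlinarith
  choose n m child hn hm hrad hchild hsep hcount hmass using
    fun p : {p : ℝ × ℕ // 0 < p.1 ∧ 1 ≤ p.2} =>
      exists_children (r := p.1.1) (M := p.1.2) hτ hs hsτ p.2.1 (by exact_mod_cast p.2.2)
  -- `St k` is the pair of the radius and the number of intervals of generation `k`.
  let St : ℕ → {p : ℝ × ℕ // 0 < p.1 ∧ 1 ≤ p.2} := fun k =>
    Nat.rec ⟨(1 / 4, 1), by norm_num, le_rfl⟩ (fun _ p => ⟨((n p : ℝ) ^ (-τ) / 4, p.1.2 * m p),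
      by have : (0 : ℝ) < n p := by exact_mod_cast hn p
         positivity,
      Nat.mul_pos p.2.2 (two_pos.trans_le (hm p))⟩) k
  let z : ℕ → ℕ → ℝ := fun k =>
    Nat.rec (fun _ => 1 / 4)
      (fun k zk b => child (St k) (zk (b / m (St k))) (b % m (St k))) k
  have hz (k b : ℕ) :
      z (k + 1) b = child (St k) (z k (b / m (St k))) (b % m (St k)) := rfl
  have hr (k : ℕ) : (St (k + 1)).1.1 = (n (St k) : ℝ) ^ (-τ) / 4 := rfl
  have hmod (k b : ℕ) : b % m (St k) < m (St k) := Nat.mod_lt _ (two_pos.trans_le (hm _))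
  have hhalf (k : ℕ) : (St (k + 1)).1.1 ≤ (St k).1.1 / 2 := hrad (St k)
  obtain ⟨f, C, hC, hf, hanti⟩ := exists_antiHolder_of_tree (m := fun k => m (St k))
    (M := fun k => (St k).1.2) (z := z) (r := fun k => (St k).1.1)
    (ε := fun k => 1 / (n (St k) : ℝ) ^ 2) (s := s) (A := 4) (c := 1 / 128) rfl (fun _ => rfl)
    (fun k => hm _) (fun k => (St k).2.1)
    (fun k b _ => by
      have h1 := (hchild (St k) (z k (b / m (St k))) _ (hmod k b)).2
      have h2 := hhalf k
      rw [hz]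
      linarith)
    (fun k b b' hb _ hdiv => by
      have h1 := Nat.div_add_mod b (m (St k))
      have h2 := Nat.div_add_mod b' (m (St k))
      have h3 : b % m (St k) < b' % m (St k) := by rw [hdiv] at h1; omega
      have h4 : ((b' : ℝ) - b) = ((b' % m (St k) : ℕ) : ℝ) - ((b % m (St k) : ℕ) : ℝ) := by
        have h5 : b' + b % m (St k) = b + b' % m (St k) := by rw [hdiv] at h1; omega
        have h6 : ((b' : ℝ) + (b % m (St k) : ℕ)) = b + (b' % m (St k) : ℕ) := by
          exact_mod_cast h5
        linarith
      rw [h4, hz, hz, hdiv]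
      exact (hsep (St k) _ _ _ h3 (hmod k b')).trans (le_abs_self _))
    (fun k => by
      have h1 : (1 : ℝ) ≤ n (St k) := by exact_mod_cast hn (St k)
      have h2 := Real.rpow_le_rpow_of_exponent_le h1 (neg_le_neg hτ)
      rw [Real.rpow_neg (by positivity) 2, Real.rpow_two, ← one_div] at h2
      simp only [hr]
      linarith)
    (by norm_num) (fun k => hcount (St k)) hs hs1
    (fun k => by
      obtain _ | k := k
      · have h4 : (1 / 4 : ℝ) ≤ (1 / 4 : ℝ) ^ s := by
          simpa using Real.rpow_le_rpow_of_exponent_ge (x := 1 / 4) (by norm_num) (by norm_num) hs1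
        change 1 ≤ 4 * ((1 : ℕ) : ℝ) * (1 / 4 : ℝ) ^ s
        push_cast
        linarith
      · have h1 := hmass (St k)
        have h2 : (((St (k + 1)).1.2 : ℕ) : ℝ) = (St k).1.2 * m (St k) := by
          change ((((St k).1.2 * m (St k) : ℕ)) : ℝ) = _
          push_cast
          rfl
        simp only [h2, hr]
        linarith)
  refine ⟨f, C, hC, fun t ht => ⟨?_, fun δ hδ => ?_⟩, hanti⟩
  · have h1 := abs_le.1 (hf t ht 0)
    have h2 : z 0 ⌊t * ((St 0).1.2 : ℕ)⌋₊ = 1 / 4 := rfl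
    have h3 : (St 0).1.1 = 1 / 4 := rfl
    rw [h2, h3] at h1
    constructor <;> linarith [h1.1, h1.2]
  · have hgeom (k : ℕ) : (St k).1.1 ≤ (1 / 2) ^ k := by
      induction k with
      | zero => change (1 / 4 : ℝ) ≤ _; norm_num
      | succ k ih => rw [pow_succ]; linarith [hhalf k]
    obtain ⟨k, hk⟩ := exists_pow_lt_of_lt_one hδ (show (1 / 2 : ℝ) < 1 by norm_num)
    have h1 := hf t ht (k + 1)
    simp only [hz] at h1
    generalize ⌊t * ((St (k + 1)).1.2 : ℕ)⌋₊ = b at h1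
    set w : ℚ := child (St k) (z k (b / m (St k))) (b % m (St k)) with hw
    refine ⟨w, ?_, ?_⟩
    · refine h1.trans_lt ?_
      have hd : (0 : ℝ) < w.den := by exact_mod_cast w.den_pos
      have h2 : (w.den : ℝ) ≤ n (St k) := by
        exact_mod_cast (hchild (St k) (z k (b / m (St k))) _ (hmod k b)).1
      have h3 := Real.rpow_le_rpow_of_nonpos hd h2 (show -τ ≤ 0 by linarith)
      have h4 := (St (k + 1)).2.1
      rw [hr] at h4 ⊢
      linarith
    · have h2 := hgeom k
      have h3 := hhalf k
      have h4 := (St k).2.1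
      linarith

/-! ### The lower bound on the torus -/

theorem dist_coe_circ_le (x y : ℝ) : dist (x : Circ) (y : Circ) ≤ |x - y| := by
  rw [dist_eq_norm, ← AddCircle.coe_sub, ← Real.norm_eq_abs]
  exact QuotientAddGroup.norm_mk_le_norm

theorem dist_coe_circ_of_mem_Icc {x y : ℝ} (hx : x ∈ Icc (0 : ℝ) (1 / 2))
    (hy : y ∈ Icc (0 : ℝ) (1 / 2)) : dist (x : Circ) (y : Circ) = |x - y| := by
  rw [dist_eq_norm, ← AddCircle.coe_sub, AddCircle.norm_coe_eq_abs_iff _ one_ne_zero, abs_one,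
    abs_le]
  constructor <;> linarith [hx.1, hx.2, hy.1, hy.2]

theorem not_isRationalPoint_coe {x : ℝ} (hx : Irrational x) : ¬ IsRationalPoint (x : Circ) := by
  rintro ⟨r, hr⟩
  rw [← sub_eq_zero, ← AddCircle.coe_sub, AddCircle.coe_eq_zero_iff] at hr
  obtain ⟨n, hn⟩ := hr
  refine hx ⟨r - n, ?_⟩
  push_cast
  simp only [zsmul_eq_mul, mul_one] at hn
  linarith

/-- The points of the circle whose irrationality exponent is at least `μ`. -/
def wellApproximable (μ : ℝ) : Set Circ := {ξ | (μ : EReal) ≤ irrExponent ξ}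

/-- The rationals close to a positive irrational number are eventually in `(0, 1)`, where numerator
and denominator form a reduced pair. That infinitely many pairs occur follows as `x` is at positive
distance from any finite set of rational points. -/
theorem coe_mem_wellApproximable {x τ : ℝ} (hx : Irrational x) (hx01 : x ∈ Icc (0 : ℝ) (1 / 2))
    (h : ∀ δ > 0, ∃ w : ℚ, |x - w| < (w.den : ℝ) ^ (-τ) ∧ |x - w| < δ) :
    (x : Circ) ∈ wellApproximable τ := by
  have hnr := not_isRationalPoint_coe hx
  have hx0 : 0 < x := hx01.1.lt_of_ne hx.ne_zero.symm
  rw [wellApproximable, mem_ofPred_eq, irrExponent, if_neg hnr]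
  refine le_sSup ⟨τ, ?_, rfl⟩
  intro hfin
  -- If there were finitely many pairs, `x` would keep a positive distance `δ` from all of them.
  have hdist : ∀ y ∈ {y ∈ reducedPairs | dist (x : Circ) (ratPoint y.1 y.2) < (y.2 : ℝ) ^ (-τ)},
      ∀ᶠ δ in 𝓝[>] (0 : ℝ), δ < dist (x : Circ) (ratPoint y.1 y.2) := by
    intro y _
    refine mem_of_superset (Ioo_mem_nhdsGT (dist_pos.2 fun h => hnr ⟨(y.1 : ℚ) / y.2, ?_⟩))
      fun δ hδ => hδ.2
    rw [h, ratPoint]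
    push_cast
    rfl
  obtain ⟨δ, hδ1, hδ2, hδ3⟩ := (((eventually_all_finite hfin).2 hdist).and
    ((show ∀ᶠ δ in 𝓝[>] (0 : ℝ), δ < min x (1 / 2) from
      mem_of_superset (Ioo_mem_nhdsGT (lt_min hx0 one_half_pos)) fun δ hδ => hδ.2).and
      self_mem_nhdsWithin)).exists
  obtain ⟨w, hw1, hw2⟩ := h δ hδ3
  have hδx := hδ2.trans_le (min_le_left _ _)
  have hδh := hδ2.trans_le (min_le_right _ _)
  have habs := abs_lt.1 hw2
  have hw0 : (0 : ℚ) < w := by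
    have : (0 : ℝ) < w := by linarith [habs.2]
    exact_mod_cast this
  have hwlt : w < 1 := by
    have : (w : ℝ) < 1 := by linarith [habs.1, hx01.2]
    exact_mod_cast this
  have hnum : ((w.num.natAbs : ℕ) : ℤ) = w.num :=
    Int.natAbs_of_nonneg (Rat.num_pos.2 hw0).le
  have hpt : ratPoint w.num.natAbs w.den = ((w : ℝ) : Circ) := by
    rw [ratPoint, Rat.cast_def w]
    have : ((w.num.natAbs : ℕ) : ℝ) = (w.num : ℝ) := by
      rw [← Int.cast_natCast, hnum]
    rw [this]
  have hle : dist (x : Circ) (ratPoint w.num.natAbs w.den) ≤ |x - w| := by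
    rw [hpt]
    exact dist_coe_circ_le _ _
  have hmem : (w.num.natAbs, w.den) ∈
      {y ∈ reducedPairs | dist (x : Circ) (ratPoint y.1 y.2) < (y.2 : ℝ) ^ (-τ)} := by
    refine ⟨⟨?_, w.reduced⟩, hle.trans_lt hw1⟩
    have := Rat.num_lt_denom_iff.2 hwlt
    change w.num.natAbs < w.den
    omega
  exact absurd (hδ1 _ hmem) (not_lt.2 (hle.trans hw2.le))

/-- On `[0, 1/2]` the projection to the circle is an isometry, so bounds for real parametrizations
into this interval carry over to the circle. -/
theorem edist_le_of_abs_sub_le {f : ℝ → ℝ} {A : Set ℝ} {C s : ℝ} (hC : 0 ≤ C) (hs : 0 ≤ s)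
    (hfA : ∀ t ∈ A, f t ∈ Icc (0 : ℝ) (1 / 2))
    (hf : ∀ t ∈ A, ∀ t' ∈ A, |t - t'| ≤ C * |f t - f t'| ^ s) :
    ∀ t ∈ A, ∀ t' ∈ A,
      edist t t' ≤ C.toNNReal * edist (f t : Circ) (f t' : Circ) ^ (s.toNNReal : ℝ) := by
  intro t ht t' ht'
  rw [edist_dist, edist_dist, dist_coe_circ_of_mem_Icc (hfA t ht) (hfA t' ht'), Real.dist_eq,
    Real.coe_toNNReal s hs, ENNReal.ofReal_rpow_of_nonneg (abs_nonneg _) hs,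
    ← ENNReal.ofReal, ← ENNReal.ofReal_mul hC]
  exact ENNReal.ofReal_le_ofReal (hf t ht t' ht')

theorem ofReal_add_cantorDim_le_dimH {s τ : ℝ} (hτ : 2 ≤ τ) (hs : 0 < s) (hsτ : τ * s < 2) :
    ENNReal.ofReal (s + cantorDim) ≤ dimH (wellApproximable τ ×ˢ cantorCirc) := by
  obtain ⟨f, C, hC, hf, hfanti⟩ := exists_antiHolder_approximable hτ hs hsτ
  obtain ⟨g, hg, hganti⟩ := exists_antiHolder_cantorSet
  let A : Set ℝ := {t ∈ Ico (0 : ℝ) 1 | Irrational (f t)}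
  have hinj : InjOn f (Ico 0 1) := by
    intro t ht t' ht' h
    have := hfanti t ht t' ht'
    rw [h, sub_self, abs_zero, Real.zero_rpow hs.ne', mul_zero] at this
    exact sub_eq_zero.1 (abs_eq_zero.1 (le_antisymm this (abs_nonneg _)))
  -- Rational points have exponent `1`, so the parameters that lead to them are left out.
  have hcount : {t ∈ Ico (0 : ℝ) 1 | ¬ Irrational (f t)}.Countable :=
    MapsTo.countable_of_injOn (t := range ((↑) : ℚ → ℝ)) (fun t ht => not_not.1 ht.2)
      (hinj.mono fun t ht => ht.1) (countable_range _)
  have hA : volume A ≠ 0 := by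
    intro h0
    have h1 : volume (Ico (0 : ℝ) 1) ≤ volume A + volume {t ∈ Ico (0 : ℝ) 1 | ¬ Irrational (f t)} :=
      (measure_mono fun t ht => by
        by_cases h : Irrational (f t)
        exacts [Or.inl ⟨ht, h⟩, Or.inr ⟨ht, h⟩]).trans (measure_union_le _ _)
    rw [h0, hcount.measure_zero, Real.volume_Ico] at h1
    norm_num at h1
  have hB : volume (Ico (0 : ℝ) 1) ≠ 0 := by rw [Real.volume_Ico]; norm_num
  have := add_le_dimH_of_antiHolder (f := fun t => (f t : Circ)) (g := fun t => (g t : Circ))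
    (C := C.toNNReal) (C' := (4 : ℝ).toNNReal) (by simpa using hC) (by norm_num)
    (edist_le_of_abs_sub_le hC.le hs.le (fun t ht => (hf t ht.1).1)
      fun t ht t' ht' => hfanti t ht.1 t' ht'.1)
    (edist_le_of_abs_sub_le (by norm_num) cantorDim_pos.le (fun t ht => (hg t ht).2) hganti) hA hB
    (E := wellApproximable τ ×ˢ cantorCirc) fun t ht u hu =>
      ⟨coe_mem_wellApproximable ht.2 (hf t ht.1).1 (hf t ht.1).2, ⟨g u, (hg u hu).1, rfl⟩⟩
  rwa [← Real.toNNReal_add hs.le cantorDim_pos.le] at this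

theorem sub_mem_cantorCirc_iff {ξ α : Circ} : ξ ∈ rotatedCantor α ↔ ξ - α ∈ cantorCirc := by
  constructor
  · rintro ⟨x, hx, rfl⟩
    simpa using hx
  · exact fun h => ⟨ξ - α, h, add_sub_cancel _ _⟩

/-- The shear `(ξ, α) ↦ (ξ, ξ - α)` is a Lipschitz involution that carries the set of pairs to a
product. -/
theorem dimH_doublyMetricSet (μ : ℝ) :
    dimH (doublyMetricSet μ) = dimH (wellApproximable μ ×ˢ cantorCirc) := by
  let Ψ : Circ × Circ → Circ × Circ := fun x => (x.1, x.1 - x.2)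
  have hΨ : LipschitzWith 2 Ψ := by
    have h := LipschitzWith.prod_fst.sub (LipschitzWith.prod_snd (α := Circ) (β := Circ))
    exact (LipschitzWith.prod_fst.prodMk h).weaken (by norm_num)
  have hinv : Function.Involutive Ψ := fun x => by simp [Ψ]
  have hpre : doublyMetricSet μ = Ψ ⁻¹' (wellApproximable μ ×ˢ cantorCirc) := by
    ext x
    simp only [doublyMetricSet, sub_mem_cantorCirc_iff, Ψ, wellApproximable, mem_preimage, mem_prod,
      mem_ofPred_eq, and_comm]
  refine le_antisymm ?_ ?_
  · rw [hpre, ← hinv.image_eq_preimage_symm]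
    exact hΨ.dimH_image_le _
  · rw [hpre]
    calc _ = dimH (Ψ '' (Ψ ⁻¹' (wellApproximable μ ×ˢ cantorCirc))) := by
          rw [image_preimage_eq _ hinv.surjective]
      _ ≤ _ := hΨ.dimH_image_le _

/-! ### The upper bound -/

theorem exists_cover_preCantorSet (n : ℕ) : ∃ J : ℕ → Set ℝ,
    preCantorSet n ⊆ ⋃ j ∈ Iio (2 ^ n), J j ∧
      ∀ j, ∀ x ∈ J j, ∀ y ∈ J j, |x - y| ≤ ((3 : ℝ) ^ n)⁻¹ := by
  induction n with
  | zero =>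
    refine ⟨fun _ => Icc 0 1, fun x hx => mem_biUnion (x := 0) (by simp) hx, ?_⟩
    intro _ x hx y hy
    rw [abs_le]
    constructor <;> norm_num <;> linarith [hx.1, hx.2, hy.1, hy.2]
  | succ n ih =>
    obtain ⟨J, hJ, hd⟩ := ih
    refine ⟨fun j => if j < 2 ^ n then (· / 3) '' J j else (fun x => (2 + x) / 3) '' J (j - 2 ^ n),
      ?_, ?_⟩
    · rintro _ (⟨x, hx, rfl⟩ | ⟨x, hx, rfl⟩)
      · obtain ⟨j, hj, hxj⟩ := mem_iUnion₂.1 (hJ hx)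
        rw [mem_Iio] at hj
        refine mem_iUnion₂.2 ⟨j, ?_, ?_⟩
        · rw [mem_Iio, pow_succ]; omega
        · dsimp only; rw [if_pos hj]; exact ⟨x, hxj, rfl⟩
      · obtain ⟨j, hj, hxj⟩ := mem_iUnion₂.1 (hJ hx)
        rw [mem_Iio] at hj
        refine mem_iUnion₂.2 ⟨j + 2 ^ n, ?_, ?_⟩
        · rw [mem_Iio, pow_succ]; omega
        · dsimp only; rw [if_neg (by omega), Nat.add_sub_cancel]; exact ⟨x, hxj, rfl⟩
    · intro j
      have h3 : ((3 : ℝ) ^ (n + 1))⁻¹ = ((3 : ℝ) ^ n)⁻¹ / 3 := by rw [pow_succ, mul_inv]; ring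
      dsimp only
      split_ifs
      · rintro _ ⟨x, hx, rfl⟩ _ ⟨y, hy, rfl⟩
        dsimp only
        rw [← sub_div, abs_div, abs_of_pos (show (0 : ℝ) < 3 by norm_num), h3]
        have := hd j x hx y hy
        gcongr
      · rintro _ ⟨x, hx, rfl⟩ _ ⟨y, hy, rfl⟩
        dsimp only
        rw [← sub_div, add_sub_add_left_eq_sub, abs_div,
          abs_of_pos (show (0 : ℝ) < 3 by norm_num), h3]
        have := hd _ x hx y hy
        gcongr

/-- The Cantor set is covered by `O(ρ ^ (-κ))` sets of diameter at most `ρ`. -/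
theorem exists_cover_cantorCirc {ρ : ℝ} (hρ : 0 < ρ) (hρ1 : ρ ≤ 1) :
    ∃ (N : ℕ) (J : Fin N → Set Circ),
    (N : ℝ) ≤ 2 * (ρ⁻¹) ^ cantorDim ∧ cantorCirc ⊆ ⋃ j, J j ∧
      ∀ j, ∀ x ∈ J j, ∀ y ∈ J j, dist x y ≤ ρ := by
  obtain ⟨n, hn1, hn2⟩ := exists_nat_pow_near ((one_le_inv₀ hρ).2 hρ1)
    (show (1 : ℝ) < 3 by norm_num)
  obtain ⟨J, hJ, hd⟩ := exists_cover_preCantorSet (n + 1)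
  refine ⟨2 ^ (n + 1), fun j => (fun x : ℝ => (x : Circ)) '' J j, ?_, ?_, ?_⟩
  · push_cast
    rw [pow_succ, mul_comm, ← three_pow_rpow_cantorDim]
    have := cantorDim_pos.le
    gcongr
  · rintro _ ⟨x, hx, rfl⟩
    obtain ⟨j, hj, hxj⟩ := mem_iUnion₂.1 (hJ (mem_iInter.1 hx (n + 1)))
    exact mem_iUnion.2 ⟨⟨j, hj⟩, x, hxj, rfl⟩
  · rintro j _ ⟨x, hx, rfl⟩ _ ⟨y, hy, rfl⟩
    exact (dist_coe_circ_le x y).trans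
      ((hd j x hx y hy).trans (inv_le_of_inv_le₀ hρ hn2.le))

theorem ApproxInfinitelyOften.mono {ξ : Circ} {s τ : ℝ} (h : ApproxInfinitelyOften ξ s)
    (hτ : τ ≤ s) : ApproxInfinitelyOften ξ τ := by
  refine Set.Infinite.mono (fun y hy => ⟨hy.1, hy.2.trans_le ?_⟩) h
  have : 1 ≤ y.2 := Nat.one_le_of_lt hy.1.1
  exact Real.rpow_le_rpow_of_exponent_le (by exact_mod_cast this) (by linarith)

theorem approxInfinitelyOften_of_mem_wellApproximable {μ τ : ℝ} (hμ : 2 ≤ μ) (hτ : τ < μ) {ξ : Circ}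
    (h : ξ ∈ wellApproximable μ) : ApproxInfinitelyOften ξ τ := by
  rw [wellApproximable, mem_ofPred_eq, irrExponent] at h
  split_ifs at h with hr
  · have : μ ≤ 1 := by exact_mod_cast h
    linarith
  · obtain ⟨_, ⟨s, hs, rfl⟩, hlt⟩ := lt_sSup_iff.1 ((EReal.coe_lt_coe_iff.2 hτ).trans_le h)
    exact hs.mono (EReal.coe_lt_coe_iff.1 hlt).le

theorem ApproxInfinitelyOften.exists_ge {ξ : Circ} {τ : ℝ} (h : ApproxInfinitelyOften ξ τ)
    (N : ℕ) : ∃ p q : ℕ, N ≤ q ∧ p < q ∧ dist ξ (ratPoint p q) < (q : ℝ) ^ (-τ) := by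
  by_contra! hcon
  refine h (((finite_Iio N).prod (finite_Iio N)).subset fun y hy => ?_)
  have h2 : y.2 < N := by
    by_contra! h2
    exact absurd hy.2 (not_lt.2 (hcon y.1 y.2 h2 hy.1.1))
  exact ⟨hy.1.1.trans h2, h2⟩

/-- The balls of radius `q ^ (-τ)` about the rational points of denominator `q`, multiplied by the
sets of a cover of `K` at the same scale, form a cover whose `(σ + κ)`-dimensional sum over all `q`
is of the order of `∑ q ^ (1 - τ σ)`. This converges, and the tails still cover. -/
theorem hausdorffMeasure_wellApproximable_prod {μ τ σ : ℝ} (hμ : 2 ≤ μ) (hτ0 : 0 < τ) (hτ : τ < μ)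
    (hσ : 0 < σ) (hτσ : 2 < τ * σ) :
    Measure.hausdorffMeasure (σ + cantorDim) (wellApproximable μ ×ˢ cantorCirc) = 0 := by
  -- Denominators are shifted by one, so that `q` runs over all natural numbers.
  have hκ := cantorDim_pos
  have hscale (q : ℕ) : 0 < ((q + 1 : ℕ) : ℝ) ^ (-τ) ∧ ((q + 1 : ℕ) : ℝ) ^ (-τ) ≤ 1 :=
    ⟨by positivity, Real.rpow_le_one_of_one_le_of_nonpos (by push_cast; linarith) (by linarith)⟩
  choose n J hn hJ hd using fun q : ℕ => exists_cover_cantorCirc (hscale q).1 (hscale q).2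
  let F : ℕ → ℝ≥0∞ := fun q => ENNReal.ofReal
    (2 * 2 ^ (σ + cantorDim) * ((q + 1 : ℕ) : ℝ) ^ (1 - τ * σ))
  have hF : ∑' q, F q ≠ ∞ := by
    have h1 : Summable fun q : ℕ => ((q + 1 : ℕ) : ℝ) ^ (1 - τ * σ) :=
      (summable_nat_add_iff 1).2 (Real.summable_nat_rpow.2 (by linarith))
    exact (h1.mul_left _).tsum_ofReal_ne_top
  let t : ∀ N : ℕ, (Σ q : ℕ, Fin (q + N + 1) × Fin (n (q + N))) → Set (Circ × Circ) := fun N i =>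
    Metric.closedBall (ratPoint i.2.1 (i.1 + N + 1)) (((i.1 + N + 1 : ℕ) : ℝ) ^ (-τ)) ×ˢ
      J (i.1 + N) i.2.2
  have hdiam (N : ℕ) (i) : Metric.ediam (t N i) ≤
      ENNReal.ofReal (2 * ((i.1 + N + 1 : ℕ) : ℝ) ^ (-τ)) := by
    refine Metric.ediam_le fun x hx y hy => ?_
    rw [edist_dist]
    refine ENNReal.ofReal_le_ofReal (max_le ?_ ?_)
    · linarith [dist_triangle_right x.1 y.1 (ratPoint i.2.1 (i.1 + N + 1)),
        Metric.mem_closedBall.1 hx.1, Metric.mem_closedBall.1 hy.1]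
    · linarith [hd (i.1 + N) i.2.2 _ hx.2 _ hy.2, (hscale (i.1 + N)).1]
  have hsum (N : ℕ) : ∑' i, Metric.ediam (t N i) ^ (σ + cantorDim) ≤ ∑' q, F (q + N) := by
    rw [ENNReal.tsum_sigma']
    refine ENNReal.tsum_le_tsum fun q => ?_
    set Q : ℝ := ((q + N + 1 : ℕ) : ℝ) with hQ
    have hQ0 : 0 < Q := by rw [hQ]; positivity
    calc ∑' i, Metric.ediam (t N ⟨q, i⟩) ^ (σ + cantorDim)
        ≤ ∑' _ : Fin (q + N + 1) × Fin (n (q + N)),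
            ENNReal.ofReal ((2 * Q ^ (-τ)) ^ (σ + cantorDim)) := by
          refine ENNReal.tsum_le_tsum fun i => ?_
          rw [← ENNReal.ofReal_rpow_of_nonneg (by positivity) (by positivity)]
          gcongr
          exact hdiam N ⟨q, i⟩
      _ = ENNReal.ofReal (Q * n (q + N) * (2 * Q ^ (-τ)) ^ (σ + cantorDim)) := by
          rw [tsum_fintype, Finset.sum_const, nsmul_eq_mul, Finset.card_univ, Fintype.card_prod,
            Fintype.card_fin, Fintype.card_fin, ENNReal.ofReal_mul (by positivity), hQ,
            ← Nat.cast_mul, ENNReal.ofReal_natCast]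
      _ ≤ F (q + N) := by
          refine ENNReal.ofReal_le_ofReal ?_
          calc Q * n (q + N) * (2 * Q ^ (-τ)) ^ (σ + cantorDim)
              ≤ Q * (2 * ((Q ^ (-τ))⁻¹) ^ cantorDim) * (2 * Q ^ (-τ)) ^ (σ + cantorDim) := by
                gcongr
                exact hn (q + N)
            _ = 2 * 2 ^ (σ + cantorDim) * Q ^ (1 - τ * σ) := by
                rw [Real.mul_rpow (by norm_num) (by positivity), ← Real.rpow_neg hQ0.le,
                  ← Real.rpow_mul hQ0.le, ← Real.rpow_mul hQ0.le]
                have : Q ^ (1 - τ * σ) =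
                    Q * (Q ^ (- -τ * cantorDim) * Q ^ (-τ * (σ + cantorDim))) := by
                  rw [← Real.rpow_add hQ0, ← Real.rpow_one_add' hQ0.le]
                  · congr 1; ring
                  · have : 1 + (- -τ * cantorDim + -τ * (σ + cantorDim)) = 1 - τ * σ := by ring
                    rw [this]; linarith
                rw [this]
                ring
  have hlim := ENNReal.tendsto_sum_nat_add F hF
  have hr : Tendsto (fun N : ℕ => ENNReal.ofReal (2 * ((N + 1 : ℕ) : ℝ) ^ (-τ))) atTop (𝓝 0) := by
    rw [← ENNReal.ofReal_zero, ← mul_zero (2 : ℝ)]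
    refine ENNReal.tendsto_ofReal (Tendsto.const_mul 2 ?_)
    exact (tendsto_rpow_neg_atTop hτ0).comp
      (tendsto_natCast_atTop_atTop.comp (tendsto_add_atTop_nat 1))
  have hmain := Measure.hausdorffMeasure_le_liminf_tsum (σ + cantorDim)
    (wellApproximable μ ×ˢ cantorCirc) _ hr t
    (Eventually.of_forall fun N i => (hdiam N i).trans (ENNReal.ofReal_le_ofReal (by
      have : ((N + 1 : ℕ) : ℝ) ≤ ((i.1 + N + 1 : ℕ) : ℝ) := by exact_mod_cast (by omega)
      have := Real.rpow_le_rpow_of_nonpos (by positivity) this (show -τ ≤ 0 by linarith)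
      linarith)))
    (Eventually.of_forall fun N => by
      rintro ⟨ξ, k⟩ ⟨hξ, hk⟩
      obtain ⟨p, q, hNq, hpq, hdist⟩ :=
        (approxInfinitelyOften_of_mem_wellApproximable hμ hτ hξ).exists_ge (N + 1)
      obtain ⟨q', rfl⟩ : ∃ q', q = q' + N + 1 := ⟨q - (N + 1), by omega⟩
      obtain ⟨j, hj⟩ := mem_iUnion.1 (hJ (q' + N) hk)
      exact mem_iUnion.2 ⟨⟨q', ⟨p, hpq⟩, j⟩, hdist.le, hj⟩)
  refine le_antisymm (hmain.trans ?_) zero_le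
  calc _ ≤ liminf (fun N => ∑' q, F (q + N)) atTop := liminf_le_liminf (Eventually.of_forall hsum)
    _ = 0 := hlim.liminf_eq

end CantorApprox

theorem mainTheorem3 (μ : ℝ) (hμ : 2 ≤ μ) :
    dimH (CantorApprox.doublyMetricSet μ) =
      ENNReal.ofReal (2 / μ + Real.log 2 / Real.log 3) := by
  have hμ0 : 0 < μ := by linarith
  have hκ := CantorApprox.cantorDim_pos
  have hcont : ContinuousAt (fun s : ℝ => ENNReal.ofReal (s + CantorApprox.cantorDim)) (2 / μ) :=
    ENNReal.continuous_ofReal.continuousAt.comp (by fun_prop)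
  rw [CantorApprox.dimH_doublyMetricSet]
  apply le_antisymm
  · refine ge_of_tendsto (hcont.tendsto.mono_left (nhdsWithin_le_nhds (s := Set.Ioi (2 / μ)))) ?_
    filter_upwards [self_mem_nhdsWithin] with σ hσ
    have hσ0 : 0 < σ := (div_pos two_pos hμ0).trans hσ
    obtain ⟨τ, hτ1, hτ2⟩ := exists_between ((div_lt_comm₀ hμ0 hσ0).1 hσ)
    rw [div_lt_iff₀ hσ0] at hτ1
    have hτ0 : 0 < τ := by
      by_contra! h
      nlinarith
    refine dimH_le_of_hausdorffMeasure_ne_top (d := (σ + CantorApprox.cantorDim).toNNReal) ?_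
    rw [Real.coe_toNNReal _ (by positivity),
      CantorApprox.hausdorffMeasure_wellApproximable_prod hμ hτ0 hτ2 hσ0 hτ1]
    exact ENNReal.zero_ne_top
  · refine le_of_tendsto (hcont.tendsto.mono_left (nhdsWithin_le_nhds (s := Set.Iio (2 / μ)))) ?_
    filter_upwards [Ioo_mem_nhdsLT (div_pos two_pos hμ0)] with s hs
    refine CantorApprox.ofReal_add_cantorDim_le_dimH hμ hs.1 ?_
    have := (lt_div_iff₀ hμ0).1 hs.2
    linarith
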